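/- Theorem 1.1. Let $R$ be a commutative Noetherian ring, let $I$ be a principal ideal of $R$, and let $M$, $N$ be finitely generated $R$-modules. For $j\ge 0$ let $$H^j_I(M,N)=\varinjlim_{n}\operatorname{Ext}^j_R(M/I^nM,N)$$ be the $j$-th generalized local cohomology module of $M$ and $N$ with respect to $I$, where the transition maps are induced by the natural surjections $M/I^{n}M\to M/I^{m}M$ for $m\le n$. Then for every $j\ge 0$ the $R$-module $H^j_I(M,N)$ is $I$-cofinite; that is, $\operatorname{Supp}_R(H^j_I(M,N))\subseteq V(I)=\{\mathfrak p\in\operatorname{Spec}R : I\subseteq\mathfrak p\}$, and $\operatorname{Ext}^i_R(R/I,H^j_I(M,N))$ is a finitely generated $R$-module for all $i\ge 0$. -/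

import Mathlib

open CategoryTheory CategoryTheory.Abelian

universe u

/-- For `m ≤ n`, the map `Ext^j_R(M/I^m M, N) → Ext^j_R(M/I^n M, N)` induced by the natural
surjection `M/I^n M → M/I^m M`. -/
noncomputable def genLocalCohomologyTransition {R : Type u} [CommRing R] (I : Ideal R)
    (M N : Type u) [AddCommGroup M] [Module R M] [AddCommGroup N] [Module R N] (j : ℕ)
    (m n : ℕ) (h : m ≤ n) :
    Ext (ModuleCat.of R (M ⧸ (I ^ m • ⊤ : Submodule R M))) (ModuleCat.of R N) j →ₗ[R]
      Ext (ModuleCat.of R (M ⧸ (I ^ n • ⊤ : Submodule R M))) (ModuleCat.of R N) j :=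
  Ext.precompOfLinear
    (Ext.mk₀ (ModuleCat.ofHom
      (Submodule.factor (Submodule.smul_mono_left (Ideal.pow_le_pow_right h)))))
    R (ModuleCat.of R N) (zero_add j)

/-- The modules `Ext^j_R(M/I^n M, N)`, `n ∈ ℕ`, form a directed system. -/
instance genLocalCohomology_directedSystem {R : Type u} [CommRing R] (I : Ideal R)
    (M N : Type u) [AddCommGroup M] [Module R M] [AddCommGroup N] [Module R N] (j : ℕ) :
    DirectedSystem
      (fun n : ℕ => Ext (ModuleCat.of R (M ⧸ (I ^ n • ⊤ : Submodule R M))) (ModuleCat.of R N) j)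
      (fun m n h => genLocalCohomologyTransition I M N j m n h) where
  map_self i x := by
    have : ModuleCat.ofHom (Submodule.factor (Submodule.smul_mono_left (N := (⊤ : Submodule R M))
        (Ideal.pow_le_pow_right (I := I) (le_refl i)))) = 𝟙 _ := by
      ext y
      rfl
    change (Ext.mk₀ _).comp x (zero_add j) = x
    rw [this, Ext.mk₀_id_comp]
  map_map k i l hki hil x := by
    have : ModuleCat.ofHom (Submodule.factor (Submodule.smul_mono_left (N := (⊤ : Submodule R M))
          (Ideal.pow_le_pow_right (I := I) hil))) ≫
        ModuleCat.ofHom (Submodule.factor (Submodule.smul_mono_left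
          (Ideal.pow_le_pow_right (I := I) hki))) =
        ModuleCat.ofHom (Submodule.factor (Submodule.smul_mono_left
          (Ideal.pow_le_pow_right (I := I) (hki.trans hil)))) := by
      ext y
      rfl
    simp [genLocalCohomologyTransition, this]

/-- The generalized local cohomology module `H^j_I(M, N) = colim_n Ext^j_R(M/I^n M, N)`. -/
noncomputable abbrev GenLocalCohomology {R : Type u} [CommRing R] (I : Ideal R)
    (M N : Type u) [AddCommGroup M] [Module R M] [AddCommGroup N] [Module R N] (j : ℕ) : Type u :=
  Module.DirectLimit
    (fun n : ℕ => Ext (ModuleCat.of R (M ⧸ (I ^ n • ⊤ : Submodule R M))) (ModuleCat.of R N) j)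
    (genLocalCohomologyTransition I M N j)

/-- An `R`-module `K` is `I`-cofinite if `Supp K ⊆ V(I)` and `Ext^i_R(R/I, K)` is finitely
generated for all `i`. -/
structure IsCofiniteModule {R : Type u} [CommRing R] (I : Ideal R)
    (K : Type u) [AddCommGroup K] [Module R K] : Prop where
  support_subset : Module.support R K ⊆ PrimeSpectrum.zeroLocus (I : Set R)
  finite_ext : ∀ i : ℕ, Module.Finite R (Ext (ModuleCat.of R (R ⧸ I)) (ModuleCat.of R K) i)

/-!
Write `I = (x)`. An `R`-module `K` whose `x`-torsion `K[x]` and cokernel `K / xK` are finitely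
generated has all `Ext^i_R(A, K)` finitely generated, for every finitely generated `A` killed
by `x`: multiplication by `x` on `K` factors as `K → xK → K` and acts as zero on
`Ext^i_R(A, K)`, so the image of `Ext^i_R(A, K)` in `Ext^i_R(A, xK)` dies in `Ext^i_R(A, K)`, hence
comes from `Ext^{i-1}_R(A, K / xK)`, while the kernel comes from `Ext^i_R(A, K[x])`
(`finite_ext_of_finite_ker_of_finite_quotient`).

It remains to bound `H[x]` and `H / xH` for `H = H^j_I(M, N)`. For `j = 0`, `H` embeds in
`Hom_R(M, N)`. For `j = k + 1`, the sequences `0 → x^n M → M → M / x^n M → 0` give exact sequences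
`Ext^k(M, N) → Ext^k(x^n M, N) → Ext^j(M / x^n M, N) → Ext^j(M, N)`. In the limit, `H / C` embeds
in `Ext^j(M, N)`, where `C` is the union of the images of the `Ext^k(x^n M, N)`. As `M` is
Noetherian, multiplication by `x` is an isomorphism `x^n M ≃ x^(n+1) M` for all large `n`, and its
composites with the inclusion `x^(n+1) M ⊆ x^n M` are multiplication by `x`. So, up to
isomorphism, the system `Ext^k(x^n M, N)` is eventually constant with multiplication by `x` as its
transition map, and `C` behaves like the cokernel of `E → E_x` for the finitely generated
module `E = Ext^k(x^n M, N)`, `n` large: one has `C = xC`, and `C[x]` is contained in the image of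
a single `Ext^k(x^n M, N)`. The module theory of this step is
`DirectLimit.finite_ker_and_finite_quotient`.
-/

/-! ### Generalities on `Ext` -/

section Ext

variable {R : Type u} [CommRing R]

lemma mk₀_smul_id_comp {X Y : ModuleCat.{u} R} {n : ℕ} (r : R) (e : Ext X Y n) :
    (Ext.mk₀ (r • 𝟙 X)).comp e (zero_add n) = r • e := by
  rw [Ext.mk₀_smul, Ext.smul_comp, Ext.mk₀_id_comp]

lemma ext_smul_eq_zero_of_smul_eq_zero {X Y : ModuleCat.{u} R} {n : ℕ} {r : R}
    (hr : ∀ a : X, r • a = 0) (e : Ext X Y n) : r • e = 0 := by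
  have h : r • 𝟙 X = 0 := by
    ext a
    exact hr a
  rw [← mk₀_smul_id_comp, h, Ext.mk₀_zero, Ext.zero_comp]

/-- If `r` kills the finitely generated module `A` and both the kernel and the cokernel of
multiplication by `r` on `K` are finitely generated, then so are all `Ext^i(A, K)`. -/
theorem finite_ext_of_finite_ker_of_finite_quotient [IsNoetherianRing R] (r : R)
    (A : ModuleCat.{u} R) [Module.Finite R A] (hA : ∀ a : A, r • a = 0)
    (K : Type u) [AddCommGroup K] [Module R K]
    [Module.Finite R (LinearMap.ker (LinearMap.lsmul R K r))]
    [Module.Finite R (K ⧸ LinearMap.range (LinearMap.lsmul R K r))] (i : ℕ) :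
    Module.Finite R (Ext A (ModuleCat.of R K) i) := by
  let μ : K →ₗ[R] K := LinearMap.lsmul R K r
  have : Module.Finite R (LinearMap.ker μ.rangeRestrict) := by
    rwa [LinearMap.ker_rangeRestrict]
  have h₁ : μ.rangeRestrict.shortComplexKer.ShortExact :=
    LinearMap.shortExact_shortComplexKer μ.surjective_rangeRestrict
  have exact₂ : Function.Exact (LinearMap.range μ).subtype (LinearMap.range μ).mkQ :=
    LinearMap.exact_subtype_mkQ _
  have h₂ := ModuleCat.shortComplex_shortExact
    (ModuleCat.shortComplexOfCompEqZero _ _ exact₂.linearMap_comp_eq_zero)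
    exact₂ (Submodule.injective_subtype _) (Submodule.mkQ_surjective _)
  let g : Ext A (ModuleCat.of R K) i →ₗ[R] Ext A (ModuleCat.of R (LinearMap.range μ)) i :=
    (Ext.mk₀ (ModuleCat.ofHom μ.rangeRestrict)).postcompOfLinear R A (add_zero i)
  let f : Ext A (ModuleCat.of R (LinearMap.range μ)) i →ₗ[R] Ext A (ModuleCat.of R K) i :=
    (Ext.mk₀ (ModuleCat.ofHom (LinearMap.range μ).subtype)).postcompOfLinear R A (add_zero i)
  have hfg (e) : f (g e) = 0 := by
    change (e.comp (Ext.mk₀ (ModuleCat.ofHom μ.rangeRestrict)) (add_zero i)).comp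
      (Ext.mk₀ (ModuleCat.ofHom (LinearMap.range μ).subtype)) (add_zero i) = 0
    rw [Ext.comp_assoc_of_third_deg_zero, Ext.mk₀_comp_mk₀]
    have : ModuleCat.ofHom μ.rangeRestrict ≫ ModuleCat.ofHom (LinearMap.range μ).subtype =
        r • 𝟙 (ModuleCat.of R K) := rfl
    rw [this, ← Ext.smul_eq_comp_mk₀]
    exact ext_smul_eq_zero_of_smul_eq_zero hA e
  have hkerg : (LinearMap.ker g).FG := by
    let a : Ext A (ModuleCat.of R (LinearMap.ker μ.rangeRestrict)) i →ₗ[R]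
        Ext A (ModuleCat.of R K) i :=
      (Ext.mk₀ (ModuleCat.ofHom (LinearMap.ker μ.rangeRestrict).subtype)).postcompOfLinear R A
        (add_zero i)
    have : (LinearMap.range a).FG := Module.Finite.iff_fg.mp inferInstance
    refine this.of_le fun e he ↦ ?_
    exact Ext.covariant_sequence_exact₂ A h₁ e he
  have hkerf : (LinearMap.ker f).FG := by
    cases i with
    | zero =>
      have : LinearMap.ker f = ⊥ := by
        rw [LinearMap.ker_eq_bot]
        have : Mono (ModuleCat.ofHom (LinearMap.range μ).subtype) := h₂.mono_f
        exact Ext.postcomp_mk₀_injective_of_mono A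
          (ModuleCat.ofHom (LinearMap.range μ).subtype)
      rw [this]
      exact Submodule.fg_bot
    | succ i =>
      let d : Ext A (ModuleCat.of R (K ⧸ LinearMap.range μ)) i →ₗ[R]
          Ext A (ModuleCat.of R (LinearMap.range μ)) (i + 1) :=
        h₂.extClass.postcompOfLinear R A rfl
      have : Module.Finite R (K ⧸ LinearMap.range μ) := ‹_›
      have : (LinearMap.range d).FG := Module.Finite.iff_fg.mp inferInstance
      refine this.of_le fun e he ↦ ?_
      exact Ext.covariant_sequence_exact₁ A h₂ e he rfl
  refine ⟨Submodule.fg_of_fg_map_of_fg_inf_ker g (hkerf.of_le ?_) (by rwa [top_inf_eq])⟩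
  rintro _ ⟨e, -, rfl⟩
  exact hfg e

end Ext

/-! ### A direct limit of finitely generated modules -/

/-- Let `A → F n → E n → B` be exact sequences of modules, with `B` and all `F n` finitely
generated, compatible with transition maps `s` of `F` and `t` of `E`. Suppose that for `n ≥ n₀`
there are bijections `p n : F (n + 1) → F n` whose composites with `s n (n + 1)`, in both orders,
are multiplication by `x`. Then multiplication by `x` on the direct limit of `E` has finitely
generated kernel and cokernel. Of exactness, only the inclusions of kernels in images are needed. -/
theorem DirectLimit.finite_ker_and_finite_quotient {R : Type*} [CommRing R] [IsNoetherianRing R]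
    {E F : ℕ → Type*} {A B : Type*}
    [∀ n, AddCommGroup (E n)] [∀ n, Module R (E n)]
    [∀ n, AddCommGroup (F n)] [∀ n, Module R (F n)] [∀ n, Module.Finite R (F n)]
    [AddCommGroup A] [Module R A] [AddCommGroup B] [Module R B] [Module.Finite R B]
    (t : ∀ m n, m ≤ n → E m →ₗ[R] E n) [DirectedSystem E fun m n h ↦ t m n h]
    (s : ∀ m n, m ≤ n → F m →ₗ[R] F n)
    (ρ : ∀ n, A →ₗ[R] F n) (δ : ∀ n, F n →ₗ[R] E n) (β : ∀ n, E n →ₗ[R] B)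
    (exact_ρ_δ : ∀ n f, δ n f = 0 → ∃ a, ρ n a = f)
    (exact_δ_β : ∀ n e, β n e = 0 → ∃ f, δ n f = e)
    (s_ρ : ∀ m n h a, s m n h (ρ m a) = ρ n a)
    (t_δ : ∀ m n h f, t m n h (δ m f) = δ n (s m n h f))
    (β_t : ∀ m n h e, β n (t m n h e) = β m e)
    (x : R) (n₀ : ℕ) (p : ∀ n, F (n + 1) →ₗ[R] F n)
    (hp : ∀ n, n₀ ≤ n → Function.Bijective (p n))
    (s_p : ∀ n f, s n (n + 1) n.le_succ (p n f) = x • f)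
    (p_s : ∀ n f, p n (s n (n + 1) n.le_succ f) = x • f) :
    Module.Finite R (LinearMap.ker (LinearMap.lsmul R (Module.DirectLimit E t) x)) ∧
      Module.Finite R
        (Module.DirectLimit E t ⧸ LinearMap.range (LinearMap.lsmul R (Module.DirectLimit E t) x)) := by
  let of n := Module.DirectLimit.of R ℕ E t n
  have of_t {m n h e} : of n (t m n h e) = of m e := Module.DirectLimit.of_f
  let b : Module.DirectLimit E t →ₗ[R] B := Module.DirectLimit.lift R ℕ E t β β_t
  have exists_of_ker (h) (hh : b h = 0) : ∃ n, n₀ + 1 ≤ n ∧ ∃ f, of n (δ n f) = h := by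
    obtain ⟨n, e, rfl⟩ := Module.DirectLimit.exists_of h
    rw [Module.DirectLimit.lift_of] at hh
    obtain ⟨f, rfl⟩ := exact_δ_β n e hh
    exact ⟨max n (n₀ + 1), le_max_right _ _, s n _ (le_max_left _ _) f, by rw [← t_δ, of_t]⟩
  have ker_le_range : LinearMap.ker b ≤
      LinearMap.range (LinearMap.lsmul R (Module.DirectLimit E t) x) := by
    intro h hh
    obtain ⟨n, hn, f, rfl⟩ := exists_of_ker h hh
    obtain ⟨f', rfl⟩ := (hp n (by lia)).2 f
    refine ⟨of (n + 1) (δ (n + 1) f'), ?_⟩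
    rw [LinearMap.lsmul_apply, ← map_smul, ← map_smul, ← s_p, ← t_δ, of_t]
  -- The `x`-torsion of `ker b` already comes from the single module `F (n₀ + 1)`.
  have torsion_le : LinearMap.ker (LinearMap.lsmul R (Module.DirectLimit E t) x) ⊓ LinearMap.ker b ≤
      LinearMap.range (of (n₀ + 1) ∘ₗ δ (n₀ + 1)) := by
    rintro h ⟨hx, hh⟩
    obtain ⟨n, hn, f, rfl⟩ := exists_of_ker h hh
    have hx : of n (x • δ n f) = 0 := by rwa [map_smul]
    obtain ⟨m, hnm, hm⟩ := Module.DirectLimit.of.zero_exact hx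
    let g := s n m hnm f
    have hg : δ m (x • g) = 0 := by rw [map_smul, ← t_δ, ← map_smul, hm]
    obtain ⟨a, ha⟩ := exact_ρ_δ m _ hg
    -- `f'` plays the role of `a / x`, so that `g - f'` is killed by `x`.
    obtain ⟨f', hf'⟩ := (hp n₀ le_rfl).2 (ρ n₀ a)
    have hxf' : x • f' = ρ (n₀ + 1) a := by rw [← s_p, hf', s_ρ]
    have hxy : x • (g - s (n₀ + 1) m (hn.trans hnm) f') = 0 := by
      rw [smul_sub, ← map_smul (s _ _ _) x f', hxf', s_ρ, ha, sub_self]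
    have hy : s m (m + 1) m.le_succ (g - s (n₀ + 1) m (hn.trans hnm) f') = 0 := by
      apply (hp m (by lia)).1
      rw [p_s, hxy, map_zero]
    rw [map_sub, sub_eq_zero] at hy
    refine ⟨f', ?_⟩
    calc of (n₀ + 1) (δ (n₀ + 1) f')
        = of (m + 1) (δ (m + 1) (s m (m + 1) m.le_succ (s (n₀ + 1) m (hn.trans hnm) f'))) := by
          rw [← t_δ, ← t_δ, of_t, of_t]
      _ = of n (δ n f) := by rw [← hy, ← t_δ, ← t_δ, of_t, of_t]
  constructor
  · rw [Module.Finite.iff_fg]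
    refine Submodule.fg_of_fg_map_of_fg_inf_ker b (IsNoetherian.noetherian _) (.of_le ?_ torsion_le)
    exact Module.Finite.iff_fg.mp inferInstance
  · have : Module.Finite R (Module.DirectLimit E t ⧸ LinearMap.ker b) :=
      Module.Finite.equiv b.quotKerEquivRange.symm
    exact Module.Finite.of_surjective _ (Submodule.factor_surjective ker_le_range)

/-! ### The submodules `x ^ n M` -/

section PowSmul

variable {R : Type u} [CommRing R] (x : R) (M : Type u) [AddCommGroup M] [Module R M]

/-- The submodule `(x) ^ n M` of `M`. -/
abbrev powSmulTop (n : ℕ) : Submodule R M := Ideal.span {x} ^ n • ⊤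

variable {M} in
lemma mem_powSmulTop {n : ℕ} {y : M} : y ∈ powSmulTop x M n ↔ ∃ z, x ^ n • z = y := by
  rw [powSmulTop, Ideal.span_singleton_pow, Submodule.ideal_span_singleton_smul,
    Submodule.mem_smul_pointwise_iff_exists]
  simp

lemma powSmulTop_antitone {m n : ℕ} (h : m ≤ n) : powSmulTop x M n ≤ powSmulTop x M m :=
  Submodule.smul_mono_left (Ideal.pow_le_pow_right h)

/-- Multiplication by `x`, as a map `x ^ n M → x ^ (n + 1) M`. -/
def powSmulTopMul (n : ℕ) : powSmulTop x M n →ₗ[R] powSmulTop x M (n + 1) :=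
  (LinearMap.lsmul R M x).restrict fun y hy ↦ by
    obtain ⟨z, rfl⟩ := (mem_powSmulTop x).mp hy
    exact (mem_powSmulTop x).mpr ⟨z, by rw [LinearMap.lsmul_apply, smul_smul, pow_succ']⟩

lemma exists_powSmulTopMul_bijective [IsNoetherian R M] :
    ∃ n₀, ∀ n, n₀ ≤ n → Function.Bijective (powSmulTopMul x M n) := by
  obtain ⟨n₀, h⟩ := Filter.eventually_atTop.mp
    (Module.End.eventually_disjoint_ker_pow_range_pow (LinearMap.lsmul R M x))
  have hpow (n : ℕ) (z : M) : (LinearMap.lsmul R M x ^ n) z = x ^ n • z := by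
    rw [← LinearMap.lsmul_apply (R := R) (x ^ n) z]
    exact LinearMap.congr_fun (map_pow (Algebra.lsmul R R M) x n).symm z
  refine ⟨n₀ + 1, fun n hn ↦ ⟨?_, ?_⟩⟩
  · rw [injective_iff_map_eq_zero]
    rintro ⟨y, hy⟩ hxy
    have hy0 : x • y = 0 := congrArg Subtype.val hxy
    obtain ⟨z, hz⟩ := (mem_powSmulTop x).mp hy
    refine Subtype.ext (Submodule.disjoint_def.mp (h n (by lia)) y ?_ ⟨z, (hpow n z).trans hz⟩)
    -- `x y = 0` gives `x ^ n y = 0` since `n ≥ 1`.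
    obtain ⟨m, rfl⟩ : ∃ m, n = m + 1 := ⟨n - 1, by lia⟩
    rw [LinearMap.mem_ker, hpow, pow_succ, mul_smul, hy0, smul_zero]
  · rintro ⟨y, hy⟩
    obtain ⟨z, hz⟩ := (mem_powSmulTop x).mp hy
    exact ⟨⟨x ^ n • z, (mem_powSmulTop x).mpr ⟨z, rfl⟩⟩,
      Subtype.ext ((smul_smul x (x ^ n) z).trans (by rw [← pow_succ', hz]))⟩

/-- The sequence `0 → x ^ n M → M → M / x ^ n M → 0`. -/
abbrev powSmulTopComplex (n : ℕ) : ShortComplex (ModuleCat.{u} R) :=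
  ModuleCat.shortComplexOfCompEqZero (powSmulTop x M n).subtype (powSmulTop x M n).mkQ
    (LinearMap.exact_subtype_mkQ _).linearMap_comp_eq_zero

lemma powSmulTopComplex_shortExact (n : ℕ) : (powSmulTopComplex x M n).ShortExact :=
  ModuleCat.shortComplex_shortExact _ (LinearMap.exact_subtype_mkQ _)
    (Submodule.injective_subtype _) (Submodule.mkQ_surjective _)

/-- The natural map between the sequences `0 → x ^ n M → M → M / x ^ n M → 0`, for `m ≤ n`. -/
abbrev powSmulTopComplexHom {m n : ℕ} (h : m ≤ n) :
    powSmulTopComplex x M n ⟶ powSmulTopComplex x M m where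
  τ₁ := ModuleCat.ofHom (Submodule.inclusion (powSmulTop_antitone x M h))
  τ₂ := 𝟙 _
  τ₃ := ModuleCat.ofHom (Submodule.factor (powSmulTop_antitone x M h))
  comm₁₂ := rfl
  comm₂₃ := rfl

end PowSmul

/-! ### Generalized local cohomology -/

section GenLocalCohomology

variable {R : Type u} [CommRing R] (M N : Type u) [AddCommGroup M] [Module R M]
  [AddCommGroup N] [Module R N]

/-- Every element of `H^j_I(M, N)` is killed by a power of `I`. -/
theorem GenLocalCohomology.support_subset (I : Ideal R) (j : ℕ) :
    Module.support R (GenLocalCohomology I M N j) ⊆ PrimeSpectrum.zeroLocus (I : Set R) := by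
  intro 𝔭 h𝔭
  obtain ⟨h, hh⟩ := Module.mem_support_iff_exists_annihilator.mp h𝔭
  obtain ⟨n, e, rfl⟩ := Module.DirectLimit.exists_of h
  refine fun r hr ↦ 𝔭.isPrime.mem_of_pow_mem n (hh ?_)
  rw [Submodule.mem_annihilator_span_singleton, ← map_smul,
    ext_smul_eq_zero_of_smul_eq_zero, map_zero]
  intro a
  obtain ⟨a, rfl⟩ := Submodule.mkQ_surjective _ a
  rw [← map_smul]
  exact (Submodule.Quotient.mk_eq_zero _).mpr
    (Submodule.smul_mem_smul (Ideal.pow_mem_pow hr n) Submodule.mem_top)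

variable [IsNoetherianRing R] [Module.Finite R M] [Module.Finite R N]

theorem GenLocalCohomology.finite_zero (I : Ideal R) :
    Module.Finite R (GenLocalCohomology I M N 0) := by
  let β (n : ℕ) : Ext (ModuleCat.of R (M ⧸ (I ^ n • ⊤ : Submodule R M))) (ModuleCat.of R N) 0 →ₗ[R]
      Ext (ModuleCat.of R M) (ModuleCat.of R N) 0 :=
    (Ext.mk₀ (ModuleCat.ofHom (Submodule.mkQ (I ^ n • ⊤)))).precompOfLinear R _ (zero_add 0)
  have hβ (n) : Function.Injective (β n) := by
    have : Epi (ModuleCat.ofHom (Submodule.mkQ (I ^ n • ⊤ : Submodule R M))) :=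
      (ModuleCat.epi_iff_surjective _).mpr (Submodule.mkQ_surjective _)
    exact Ext.precomp_mk₀_injective_of_epi _ _
  refine Module.Finite.of_injective (Module.DirectLimit.lift R ℕ _ _ β fun m n h e ↦ ?_)
    (Module.DirectLimit.lift_injective _ _ hβ)
  exact Ext.mk₀_comp_mk₀_assoc _ _ _

theorem GenLocalCohomology.finite_ker_and_finite_quotient_succ (x : R) (k : ℕ) :
    let μ := LinearMap.lsmul R (GenLocalCohomology (Ideal.span {x}) M N (k + 1)) x
    Module.Finite R (LinearMap.ker μ) ∧
      Module.Finite R (GenLocalCohomology (Ideal.span {x}) M N (k + 1) ⧸ LinearMap.range μ) := by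
  obtain ⟨n₀, hn₀⟩ := exists_powSmulTopMul_bijective x M
  have hS := powSmulTopComplex_shortExact x M
  have hk : 1 + k = k + 1 := add_comm 1 k
  refine DirectLimit.finite_ker_and_finite_quotient
    (F := fun n ↦ Ext (ModuleCat.of R (powSmulTop x M n)) (ModuleCat.of R N) k)
    (A := Ext (ModuleCat.of R M) (ModuleCat.of R N) k)
    (B := Ext (ModuleCat.of R M) (ModuleCat.of R N) (k + 1))
    (genLocalCohomologyTransition (Ideal.span {x}) M N (k + 1))
    (s := fun m n h ↦ (Ext.mk₀ (powSmulTopComplexHom x M h).τ₁).precompOfLinear R _ (zero_add k))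
    (ρ := fun n ↦ (Ext.mk₀ (powSmulTopComplex x M n).f).precompOfLinear R _ (zero_add k))
    (δ := fun n ↦ (hS n).extClass.precompOfLinear R _ hk)
    (β := fun n ↦ (Ext.mk₀ (powSmulTopComplex x M n).g).precompOfLinear R _ (zero_add (k + 1)))
    (p := fun n ↦ (Ext.mk₀ (ModuleCat.ofHom (powSmulTopMul x M n))).precompOfLinear R _
      (zero_add k))
    (x := x) (n₀ := n₀) ?_ ?_ ?_ ?_ ?_ ?_ ?_ ?_
  · intro n f hf
    exact Ext.contravariant_sequence_exact₁ (hS n) _ f hk hf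
  · intro n e he
    exact Ext.contravariant_sequence_exact₃ (hS n) _ e he hk
  · intro m n h a
    exact Ext.mk₀_comp_mk₀_assoc _ _ _
  · intro m n h f
    change (Ext.mk₀ (powSmulTopComplexHom x M h).τ₃).comp ((hS m).extClass.comp f hk) (zero_add (k + 1)) =
      (hS n).extClass.comp ((Ext.mk₀ (powSmulTopComplexHom x M h).τ₁).comp f (zero_add k)) hk
    rw [← Ext.comp_assoc _ _ _ (zero_add 1) hk (by lia),
      ← ShortComplex.ShortExact.extClass_naturality (hS n) (hS m),
      Ext.comp_assoc _ _ _ (add_zero 1) (zero_add k) (by lia)]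
  · intro m n h e
    exact Ext.mk₀_comp_mk₀_assoc _ _ _
  · intro n hn
    have : IsIso (ModuleCat.ofHom (powSmulTopMul x M n)) :=
      (LinearEquiv.ofBijective _ (hn₀ n hn)).toModuleIso.isIso_hom
    refine Function.bijective_iff_has_inverse.mpr
      ⟨fun f ↦ (Ext.mk₀ (inv (ModuleCat.ofHom (powSmulTopMul x M n)))).comp f (zero_add k),
        fun f ↦ ?_, fun f ↦ ?_⟩
    · exact (Ext.mk₀_comp_mk₀_assoc _ _ _).trans (by rw [IsIso.inv_hom_id, Ext.mk₀_id_comp])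
    · exact (Ext.mk₀_comp_mk₀_assoc _ _ _).trans (by rw [IsIso.hom_inv_id, Ext.mk₀_id_comp])
  · intro n f
    exact (Ext.mk₀_comp_mk₀_assoc _ _ _).trans (mk₀_smul_id_comp x f)
  · intro n f
    exact (Ext.mk₀_comp_mk₀_assoc _ _ _).trans (mk₀_smul_id_comp x f)

end GenLocalCohomology

theorem theorem1p1 {R : Type u} [CommRing R] [IsNoetherianRing R]
    (I : Ideal R) (hI : I.IsPrincipal)
    (M N : Type u) [AddCommGroup M] [Module R M] [Module.Finite R M]
    [AddCommGroup N] [Module R N] [Module.Finite R N] (j : ℕ) :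
    IsCofiniteModule I (GenLocalCohomology I M N j) := by
  refine ⟨GenLocalCohomology.support_subset M N I j, fun i ↦ ?_⟩
  obtain ⟨x, hx⟩ := hI.principal
  obtain rfl : I = Ideal.span {x} := hx
  cases j with
  | zero =>
    have := GenLocalCohomology.finite_zero M N (Ideal.span {x})
    infer_instance
  | succ k =>
    obtain ⟨_, _⟩ := GenLocalCohomology.finite_ker_and_finite_quotient_succ M N x k
    refine finite_ext_of_finite_ker_of_finite_quotient x _ (fun a ↦ ?_) _ i
    obtain ⟨a, rfl⟩ := Submodule.mkQ_surjective _ a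
    rw [← map_smul]
    exact (Submodule.Quotient.mk_eq_zero _).mpr
      (Ideal.mul_mem_right a _ (Ideal.mem_span_singleton_self x))
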